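/- Let $n\ge 3$ and let $F_n$ be the free group with basis $\{a_1,\dots,a_n\}$. A word of $F_n$ is called palindromic if, written as a reduced word in the letters $a_i^{\pm1}$, it reads the same backwards. Let $\Pi A(F_n)$ be the palindromic automorphism group, i.e. the subgroup of $\mathrm{Aut}(F_n)$ consisting of all automorphisms that map each $a_i$ to a palindromic word. Two elements $x,y$ of a group $G$ are called $z$-equivalent if their centralizers $Z_G(x)$ and $Z_G(y)$ are conjugate in $G$; the equivalence classes of this relation are called the $z$-classes of $G$. Then the group $\Pi A(F_n)$ has infinitely many $z$-classes. -/

import Mathlib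

/-- An element of a free group is palindromic if its reduced word reads the same backwards. -/
def IsPalindromicWord {α : Type*} [DecidableEq α] (w : FreeGroup α) : Prop :=
  w.toWord.Palindrome

/-- The endomorphism of the free group that inverts every basis element. -/
def invertBasis (α : Type*) : FreeGroup α →* FreeGroup α :=
  FreeGroup.lift fun a => (FreeGroup.of a)⁻¹

theorem invertBasis_mk {α : Type*} (L : List (α × Bool)) :
    (invertBasis α (FreeGroup.mk L))⁻¹ = FreeGroup.mk L.reverse := by
  induction L with
  | nil => simp [invertBasis, ← FreeGroup.one_eq_mk]
  | cons p L ih =>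
    obtain ⟨a, b⟩ := p
    have h1 : FreeGroup.mk ((a, b) :: L) = FreeGroup.mk [(a, b)] * FreeGroup.mk L := by
      rw [FreeGroup.mul_mk]; rfl
    rw [h1, map_mul, mul_inv_rev, ih, List.reverse_cons, ← FreeGroup.mul_mk]
    congr 1
    cases b <;> simp [invertBasis, FreeGroup.of, FreeGroup.invRev]

theorem isPalindromicWord_iff {α : Type*} [DecidableEq α] (w : FreeGroup α) :
    IsPalindromicWord w ↔ invertBasis α w = w⁻¹ := by
  have key : (invertBasis α w)⁻¹ = FreeGroup.mk w.toWord.reverse := by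
    conv_lhs => rw [← FreeGroup.mk_toWord (x := w)]
    exact invertBasis_mk _
  have key' : invertBasis α w = w⁻¹ ↔ FreeGroup.mk w.toWord.reverse = w := by
    rw [← key, inv_eq_iff_eq_inv]
  rw [key', IsPalindromicWord, List.Palindrome.iff_reverse_eq]
  constructor
  · intro h
    rw [h, FreeGroup.mk_toWord]
  · intro h
    have h2 : FreeGroup.reduce w.toWord.reverse = w.toWord := by
      rw [← FreeGroup.toWord_mk, h]
    have h3 : List.Sublist w.toWord w.toWord.reverse := by
      have := (FreeGroup.reduce.red (L := w.toWord.reverse)).sublist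
      rwa [h2] at this
    exact (h3.eq_of_length (by simp)).symm

theorem palindromic_commutes_invertBasis {α : Type*} [DecidableEq α]
    (f : FreeGroup α →* FreeGroup α) :
    (∀ a, IsPalindromicWord (f (FreeGroup.of a))) ↔
      ∀ w, invertBasis α (f w) = f (invertBasis α w) := by
  simp only [isPalindromicWord_iff]
  constructor
  · intro h w
    have : (invertBasis α).comp f = f.comp (invertBasis α) := by
      ext a
      refine (h a).trans ?_
      simp [invertBasis]
    exact DFunLike.congr_fun this w
  · intro h a
    rw [h]
    simp [invertBasis]

/-- The palindromic automorphism group `ΠA(F_n)`: the automorphisms of the free group `F_n`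
that map each of the standard basis elements to a palindromic word. -/
def palindromicAut (n : ℕ) : Subgroup (MulAut (FreeGroup (Fin n))) where
  carrier := {f | ∀ i : Fin n, IsPalindromicWord (f (FreeGroup.of i))}
  one_mem' := by
    refine (palindromic_commutes_invertBasis (MonoidHom.id _)).2 ?_
    intro w
    rfl
  mul_mem' := by
    intro f g hf hg
    have hf' := (palindromic_commutes_invertBasis f.toMonoidHom).1 hf
    have hg' := (palindromic_commutes_invertBasis g.toMonoidHom).1 hg
    refine (palindromic_commutes_invertBasis (f * g).toMonoidHom).2 ?_
    intro w
    exact (hf' (g w)).trans (congrArg f (hg' w))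
  inv_mem' := by
    intro f hf
    have hf' := (palindromic_commutes_invertBasis f.toMonoidHom).1 hf
    refine (palindromic_commutes_invertBasis (f⁻¹).toMonoidHom).2 ?_
    intro w
    apply f.injective
    refine (hf' (f⁻¹ w)).symm.trans ?_
    change invertBasis _ (f (f⁻¹ w)) = f (f⁻¹ (invertBasis _ w))
    rw [MulAut.apply_inv_self, MulAut.apply_inv_self]

/-- Two elements of a group `G` are `z`-equivalent if their centralizers in `G` are conjugate
subgroups of `G`. -/
def ZEquiv {G : Type*} [Group G] (x y : G) : Prop :=
  ∃ g : G, (Subgroup.centralizer {x}).map (MulAut.conj g).toMonoidHom = Subgroup.centralizer {y}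

theorem zEquiv_equivalence (G : Type*) [Group G] : Equivalence (ZEquiv (G := G)) where
  refl x := ⟨1, by
    ext z
    simp⟩
  symm := by
    rintro x y ⟨g, h⟩
    refine ⟨g⁻¹, ?_⟩
    rw [← h]
    ext z
    simp [mul_assoc]
  trans := by
    rintro x y z ⟨g, hg⟩ ⟨k, hk⟩
    refine ⟨k * g, ?_⟩
    rw [← hk, ← hg, Subgroup.map_map]
    congr 1
    ext z
    simp [mul_assoc]

/-- The relation of `z`-equivalence on a group. -/
def zSetoid (G : Type*) [Group G] : Setoid G := ⟨ZEquiv, zEquiv_equivalence G⟩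

/-- The set of `z`-classes of a group. -/
def ZClass (G : Type*) [Group G] : Type _ := Quotient (zSetoid G)

/-! Pass to the abelianization. The twist with parameter `k` acts there as `!![1+4k, 2; 2k, 1]` plus
an identity block. If the twists for `j` and `k` are `z`-equivalent, some conjugate `f` of the first
commutes with everything commuting with the second: with that twist itself and with the inversions
of the remaining basis elements. Hence the matrix of `f` is a `2 × 2` block commuting with the one
above, plus diagonal signs. Conjugation preserves the trace of its square, which for a nonscalar
block is at least `2k(k+1) + m`, while `j` fixes its value (`le_of_zEquiv_palindromicTwist`). So `k`
cannot be much larger than `j`, and the powers of 4 give pairwise inequivalent twists. -/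

/-- The endomorphism of a free group that sends the basis element `i` to `aⱼᵏ aᵢ aⱼᵏ` and fixes
every other basis element. -/
def palindromicTransvectionHom {α : Type*} [DecidableEq α] (i j : α) (k : ℤ) :
    FreeGroup α →* FreeGroup α :=
  FreeGroup.lift fun l =>
    if l = i then FreeGroup.of j ^ k * FreeGroup.of i * FreeGroup.of j ^ k else FreeGroup.of l

theorem palindromicTransvectionHom_comp_neg {α : Type*} [DecidableEq α] {i j : α} (h : j ≠ i)
    (k : ℤ) : (palindromicTransvectionHom i j k).comp (palindromicTransvectionHom i j (-k)) =
      MonoidHom.id _ := by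
  ext l
  by_cases hl : l = i <;> simp [palindromicTransvectionHom, hl, h, mul_assoc]

/-- The palindromic automorphism sending `aᵢ` to `aⱼᵏ aᵢ aⱼᵏ` and fixing the other basis
elements. -/
def palindromicTransvection {α : Type*} [DecidableEq α] (i j : α) (h : j ≠ i) (k : ℤ) :
    MulAut (FreeGroup α) :=
  MonoidHom.toMulEquiv (palindromicTransvectionHom i j k) (palindromicTransvectionHom i j (-k))
    (by simpa using palindromicTransvectionHom_comp_neg h (-k))
    (palindromicTransvectionHom_comp_neg h k)

theorem palindromicTransvection_of {α : Type*} [DecidableEq α] (i j : α) (h : j ≠ i) (k : ℤ)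
    (l : α) : palindromicTransvection i j h k (FreeGroup.of l) =
      if l = i then FreeGroup.of j ^ k * FreeGroup.of i * FreeGroup.of j ^ k
      else FreeGroup.of l := by
  simp [palindromicTransvection, palindromicTransvectionHom]

/-- The endomorphism of a free group that inverts the basis element `i` and fixes the others. -/
def basisInversionHom {α : Type*} [DecidableEq α] (i : α) : FreeGroup α →* FreeGroup α :=
  FreeGroup.lift fun l => if l = i then (FreeGroup.of i)⁻¹ else FreeGroup.of l

theorem basisInversionHom_comp_self {α : Type*} [DecidableEq α] (i : α) :
    (basisInversionHom i).comp (basisInversionHom i) = MonoidHom.id _ := by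
  ext l
  by_cases hl : l = i <;> simp [basisInversionHom, hl]

/-- The automorphism inverting `aᵢ` and fixing the other basis elements. -/
def basisInversion {α : Type*} [DecidableEq α] (i : α) : MulAut (FreeGroup α) :=
  MonoidHom.toMulEquiv (basisInversionHom i) (basisInversionHom i)
    (basisInversionHom_comp_self i) (basisInversionHom_comp_self i)

theorem basisInversion_of {α : Type*} [DecidableEq α] (i l : α) :
    basisInversion i (FreeGroup.of l) =
      if l = i then (FreeGroup.of i)⁻¹ else FreeGroup.of l := by
  simp [basisInversion, basisInversionHom]

theorem palindromicTransvection_mem {n : ℕ} (i j : Fin n) (h : j ≠ i) (k : ℤ) :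
    palindromicTransvection i j h k ∈ palindromicAut n := by
  intro l
  rw [isPalindromicWord_iff, palindromicTransvection_of]
  split_ifs <;> simp [invertBasis, mul_assoc]

theorem basisInversion_mem {n : ℕ} (i : Fin n) : basisInversion i ∈ palindromicAut n := by
  intro l
  rw [isPalindromicWord_iff, basisInversion_of]
  split_ifs <;> simp [invertBasis]

theorem mulAut_freeGroup_ext {α : Type*} {f g : MulAut (FreeGroup α)}
    (h : ∀ l, f (FreeGroup.of l) = g (FreeGroup.of l)) : f = g := by
  have : f.toMonoidHom = g.toMonoidHom := FreeGroup.ext_hom _ _ h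
  exact MulEquiv.ext fun w => DFunLike.congr_fun this w

theorem basisInversion_commute_palindromicTransvection {α : Type*} [DecidableEq α] {i j l : α}
    (h : j ≠ i) (hi : l ≠ i) (hj : l ≠ j) (k : ℤ) :
    Commute (basisInversion l) (palindromicTransvection i j h k) := by
  refine mulAut_freeGroup_ext fun p => ?_
  rw [MulAut.mul_apply, MulAut.mul_apply, palindromicTransvection_of, basisInversion_of]
  by_cases hp : p = i
  · subst hp
    simp [basisInversion_of, palindromicTransvection_of, hi.symm, hj.symm]
  · by_cases hl : p = l
    · subst hl
      simp [basisInversion_of, palindromicTransvection_of, hp]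
    · simp [basisInversion_of, palindromicTransvection_of, hp, hl]

/-! ### Action on the abelianization -/

/-- The exponent sum of the basis element `i` in a word of a free group. -/
def exponentSum {α : Type*} [DecidableEq α] (i : α) : FreeGroup α →* Multiplicative ℤ :=
  FreeGroup.lift fun l => Multiplicative.ofAdd (if i = l then 1 else 0)

theorem exponentSum_of {α : Type*} [DecidableEq α] (i l : α) :
    (exponentSum i (FreeGroup.of l)).toAdd = if i = l then 1 else 0 := by
  simp [exponentSum]

/-- The matrix of an automorphism of a free group on the abelianization. -/
def abelianizationMatrix {α : Type*} [DecidableEq α] (f : MulAut (FreeGroup α)) :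
    Matrix α α ℤ :=
  Matrix.of fun i l => (exponentSum i (f (FreeGroup.of l))).toAdd

theorem exponentSum_apply {α : Type*} [DecidableEq α] [Fintype α] (f : MulAut (FreeGroup α))
    (i : α) (w : FreeGroup α) : (exponentSum i (f w)).toAdd =
      ∑ l, abelianizationMatrix f i l * (exponentSum l w).toAdd := by
  induction w using FreeGroup.induction_on with
  | C1 => simp
  | of l => simp [exponentSum_of, abelianizationMatrix]
  | inv_of l ih => simp [exponentSum_of, abelianizationMatrix]
  | mul x y hx hy => simp [hx, hy, mul_add, Finset.sum_add_distrib]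

theorem abelianizationMatrix_one {α : Type*} [DecidableEq α] :
    abelianizationMatrix (1 : MulAut (FreeGroup α)) = 1 := by
  ext i l
  simp [abelianizationMatrix, exponentSum_of, Matrix.one_apply]

theorem abelianizationMatrix_mul {α : Type*} [DecidableEq α] [Fintype α]
    (f g : MulAut (FreeGroup α)) :
    abelianizationMatrix (f * g) = abelianizationMatrix f * abelianizationMatrix g := by
  ext i l
  exact exponentSum_apply f i (g (FreeGroup.of l))

theorem ZEquiv.exists_conj_commute {G : Type*} [Group G] {x y : G} (h : ZEquiv x y) :
    ∃ g : G, ∀ w, Commute w y → Commute w (g * x * g⁻¹) := by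
  obtain ⟨g, hg⟩ := h
  refine ⟨g, fun w hw => ?_⟩
  have hw' : w ∈ Subgroup.centralizer {y} :=
    Subgroup.mem_centralizer_singleton_iff.2 hw.eq
  rw [← hg] at hw'
  obtain ⟨u, hu, rfl⟩ := hw'
  have hu' : Commute u x := Subgroup.mem_centralizer_singleton_iff.1 hu
  exact hu'.map (MulAut.conj g)

/-- The inversion acts as a diagonal matrix with `-1` only at `i`, so commuting with it makes each
such entry equal to its own negative. -/
theorem apply_eq_zero_of_commute_basisInversion {α : Type*} [DecidableEq α] [Fintype α]
    {f : MulAut (FreeGroup α)} {i l : α} (h : Commute (basisInversion i) f) (hl : l ≠ i) :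
    abelianizationMatrix f i l = 0 ∧ abelianizationMatrix f l i = 0 := by
  have hs (p q : α) : abelianizationMatrix (basisInversion i) p q =
      if p = q then (if q = i then -1 else 1) else 0 := by
    simp only [abelianizationMatrix, Matrix.of_apply, basisInversion_of]
    split_ifs <;> simp_all [exponentSum_of]
  have hm := congrArg abelianizationMatrix h.eq
  rw [abelianizationMatrix_mul, abelianizationMatrix_mul] at hm
  have h1 := congrFun (congrFun hm i) l
  have h2 := congrFun (congrFun hm l) i
  simp only [Matrix.mul_apply, hs] at h1 h2
  simp [hl] at h1 h2
  omega

/-! ### The twists and their traces -/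

/-- The product of two opposite palindromic transvections acting on the first two basis
elements. -/
def palindromicTwist (m : ℕ) (k : ℤ) : palindromicAut (m + 2) :=
  ⟨palindromicTransvection 1 0 (by simp) 1, palindromicTransvection_mem _ _ _ _⟩ *
    ⟨palindromicTransvection 0 1 (by simp) k, palindromicTransvection_mem _ _ _ _⟩

theorem palindromicTwist_of (m : ℕ) (k : ℤ) (l : Fin (m + 2)) :
    (palindromicTwist m k : MulAut (FreeGroup (Fin (m + 2)))) (FreeGroup.of l) =
      if l = 0 then (FreeGroup.of 0 * FreeGroup.of 1 * FreeGroup.of 0) ^ k * FreeGroup.of 0 *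
        (FreeGroup.of 0 * FreeGroup.of 1 * FreeGroup.of 0) ^ k
      else if l = 1 then FreeGroup.of 0 * FreeGroup.of 1 * FreeGroup.of 0
      else FreeGroup.of l := by
  simp only [palindromicTwist, Subgroup.coe_mul, MulAut.mul_apply, palindromicTransvection_of]
  split_ifs <;> simp_all [palindromicTransvection_of]

theorem abelianizationMatrix_palindromicTwist (m : ℕ) (k : ℤ) (p q : Fin (m + 2)) :
    abelianizationMatrix (palindromicTwist m k : MulAut (FreeGroup (Fin (m + 2)))) p q =
      if q = 0 then (if p = 0 then 1 + 4 * k else if p = 1 then 2 * k else 0)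
      else if q = 1 then (if p = 0 then 2 else if p = 1 then 1 else 0)
      else if p = q then 1 else 0 := by
  simp only [abelianizationMatrix, Matrix.of_apply, palindromicTwist_of]
  split_ifs <;> simp_all [exponentSum_of] <;> ring

theorem basisInversion_commute_palindromicTwist (m : ℕ) (k : ℤ) (i : Fin m) :
    Commute (⟨basisInversion i.succ.succ, basisInversion_mem _⟩ : palindromicAut (m + 2))
      (palindromicTwist m k) := by
  have h0 : i.succ.succ ≠ 0 := Fin.succ_ne_zero _
  have h1 : i.succ.succ ≠ 1 := Fin.succ_succ_ne_one i
  refine Commute.mul_right ?_ ?_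
  · exact Subtype.ext
      (basisInversion_commute_palindromicTransvection (by simp) h1 h0 1).eq
  · exact Subtype.ext
      (basisInversion_commute_palindromicTransvection (by simp) h0 h1 k).eq

/-- The trace of the square of a matrix that is diagonal outside the leading `2 × 2` block. -/
theorem trace_mul_self_of_block {m : ℕ} {C : Matrix (Fin (m + 2)) (Fin (m + 2)) ℤ}
    (h : ∀ (i : Fin m) l, l ≠ i.succ.succ → C i.succ.succ l = 0 ∧ C l i.succ.succ = 0) :
    (C * C).trace = C 0 0 ^ 2 + 2 * (C 0 1 * C 1 0) + C 1 1 ^ 2 +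
      ∑ i : Fin m, C i.succ.succ i.succ.succ ^ 2 := by
  have hd (i : Fin m) : (C * C) i.succ.succ i.succ.succ = C i.succ.succ i.succ.succ ^ 2 := by
    rw [Matrix.mul_apply, Finset.sum_eq_single i.succ.succ, sq]
    · intro l _ hl
      rw [(h i l hl).1, zero_mul]
    · simp
  have h0 (i : Fin m) : C 0 i.succ.succ = 0 := (h i 0 (Fin.succ_ne_zero _).symm).2
  have h1 (i : Fin m) : C 1 i.succ.succ = 0 :=
    (h i 1 (Fin.succ_succ_ne_one i).symm).2
  rw [Matrix.trace, Fin.sum_univ_succ, Fin.sum_univ_succ]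
  simp only [Matrix.diag_apply, hd]
  simp only [Matrix.mul_apply, Fin.sum_univ_succ, Fin.succ_zero_eq_one, h0, h1]
  simp
  ring

theorem trace_palindromicTwist_mul_self (m : ℕ) (k : ℤ) :
    (abelianizationMatrix (palindromicTwist m k : MulAut (FreeGroup (Fin (m + 2)))) *
      abelianizationMatrix (palindromicTwist m k : MulAut (FreeGroup (Fin (m + 2))))).trace =
      (1 + 4 * k) ^ 2 + 8 * k + 1 + m := by
  have hne (i : Fin m) : i.succ.succ ≠ 1 := Fin.succ_succ_ne_one i
  rw [trace_mul_self_of_block]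
  · simp [abelianizationMatrix_palindromicTwist, hne]
    ring
  · intro i l hl
    exact apply_eq_zero_of_commute_basisInversion
      (congrArg Subtype.val (basisInversion_commute_palindromicTwist m k i).eq) hl

/-- Squaring before taking the trace removes the unknown diagonal signs and turns the block's
contribution into a positive quadratic form. -/
theorem le_of_zEquiv_palindromicTwist {m : ℕ} {j k : ℤ} (hj : 1 ≤ j) (hk : 1 ≤ k)
    (h : ZEquiv (palindromicTwist m j) (palindromicTwist m k)) :
    2 * (k * (k + 1)) ≤ (1 + 4 * j) ^ 2 + 8 * j + 1 := by
  obtain ⟨g, hg⟩ := h.exists_conj_commute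
  have hne (i : Fin m) : i.succ.succ ≠ 1 := Fin.succ_succ_ne_one i
  set f : MulAut (FreeGroup (Fin (m + 2))) :=
    ((g * palindromicTwist m j * g⁻¹ : palindromicAut (m + 2)) :
      MulAut (FreeGroup (Fin (m + 2)))) with hf
  have hblock (i : Fin m) (l) (hl : l ≠ i.succ.succ) :
      abelianizationMatrix f i.succ.succ l = 0 ∧ abelianizationMatrix f l i.succ.succ = 0 :=
    apply_eq_zero_of_commute_basisInversion
      (congrArg Subtype.val (hg _ (basisInversion_commute_palindromicTwist m k i)).eq) hl
  have htrace : (abelianizationMatrix f * abelianizationMatrix f).trace =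
      (1 + 4 * j) ^ 2 + 8 * j + 1 + m := by
    rw [← trace_palindromicTwist_mul_self, ← abelianizationMatrix_mul,
      ← abelianizationMatrix_mul]
    have hff : f * f = g * (palindromicTwist m j * palindromicTwist m j * g⁻¹) := by
      simp [hf, mul_assoc]
    rw [hff, abelianizationMatrix_mul, Matrix.trace_mul_comm, ← abelianizationMatrix_mul,
      InvMemClass.coe_inv, inv_mul_cancel_right]
  have hcomm : (palindromicTwist m k : MulAut (FreeGroup (Fin (m + 2)))) * f =
      f * palindromicTwist m k :=
    congrArg Subtype.val (hg _ (Commute.refl (palindromicTwist m k))).eq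
  replace hcomm := congrArg abelianizationMatrix hcomm
  rw [abelianizationMatrix_mul, abelianizationMatrix_mul] at hcomm
  have hinv : abelianizationMatrix f * abelianizationMatrix f⁻¹ = 1 := by
    rw [← abelianizationMatrix_mul, mul_inv_cancel, abelianizationMatrix_one]
  rw [trace_mul_self_of_block hblock] at htrace
  generalize abelianizationMatrix f⁻¹ = D at hinv
  generalize abelianizationMatrix f = C at *
  have h0 (i : Fin m) : C 0 i.succ.succ = 0 := (hblock i 0 (Fin.succ_ne_zero _).symm).2
  -- Where row `p` vanishes off the diagonal, `C p p * D p p = 1`, so `C p p` is a unit of `ℤ`.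
  have hunit (p : Fin (m + 2)) (hp : ∀ l, l ≠ p → C p l = 0) : C p p ^ 2 = 1 := by
    have h1 := congrFun (congrFun hinv p) p
    rw [Matrix.mul_apply, Finset.sum_eq_single p, Matrix.one_apply_eq] at h1
    · exact Int.isUnit_sq (IsUnit.of_mul_eq_one _ h1)
    · intro l _ hl
      rw [hp l hl, zero_mul]
    · simp
  have hsum : ∑ i : Fin m, C i.succ.succ i.succ.succ ^ 2 = m := by
    rw [Finset.sum_congr rfl fun i _ => hunit _ fun l hl => (hblock i l hl).1]
    simp
  have h00 := congrFun (congrFun hcomm 0) 0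
  have h01 := congrFun (congrFun hcomm 0) 1
  simp [Matrix.mul_apply, Fin.sum_univ_succ, abelianizationMatrix_palindromicTwist, hne,
    (Fin.succ_ne_zero _).symm] at h00 h01
  have hc : C 1 0 = k * C 0 1 := by linarith
  have ha : C 0 0 = C 1 1 + 2 * k * C 0 1 := by linarith
  rw [hsum] at htrace
  -- If `C 0 1 = 0`, the block is `±1` times the identity and contributes only 2 to the trace, too
  -- little for `j ≥ 1`.
  by_cases hb : C 0 1 = 0
  · have hu := hunit 0 fun l hl => by
      refine Fin.cases (fun h => absurd rfl h) (fun l => ?_) l hl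
      refine Fin.cases (fun _ => hb) (fun i _ => h0 i) l
    rw [hb] at ha hc htrace
    rw [mul_zero, add_zero] at ha
    rw [← ha, hu] at htrace
    nlinarith
  · have hb1 : 1 ≤ C 0 1 ^ 2 := by
      have := sq_nonneg (C 0 1)
      have : C 0 1 ^ 2 ≠ 0 := pow_ne_zero 2 hb
      omega
    have hk0 : 0 ≤ 2 * (k * (k + 1)) := by positivity
    rw [hc, ha] at htrace
    -- With `a = C 1 1` and `b = C 0 1`, the block contributes `2(a + kb)² + 2k(k+1)b²`.
    nlinarith [mul_le_mul_of_nonneg_left hb1 hk0, sq_nonneg (C 1 1 + k * C 0 1)]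

theorem not_zEquiv_palindromicTwist {m : ℕ} {a b : ℕ} (h : a < b) :
    ¬ ZEquiv (palindromicTwist m (4 ^ a)) (palindromicTwist m (4 ^ b)) := by
  intro hz
  have ha : (1 : ℤ) ≤ 4 ^ a := one_le_pow₀ (by norm_num)
  have hb : (1 : ℤ) ≤ 4 ^ b := one_le_pow₀ (by norm_num)
  have hab : (4 : ℤ) * 4 ^ a ≤ 4 ^ b := by
    rw [← pow_succ']
    exact pow_le_pow_right₀ (by norm_num) h
  have := le_of_zEquiv_palindromicTwist ha hb hz
  -- For `k ≥ 4j` the bound would give `32j² + 8j ≤ 16j² + 16j + 2`, false for `j ≥ 1`.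
  nlinarith

theorem theorem1p2 (n : ℕ) (hn : 3 ≤ n) : Infinite (ZClass (palindromicAut n)) := by
  obtain ⟨m, rfl⟩ := Nat.exists_eq_add_of_le' (show 2 ≤ n by omega)
  refine Infinite.of_injective
    (fun a : ℕ => Quotient.mk (zSetoid _) (palindromicTwist m (4 ^ a))) fun a b hab => ?_
  have hz : ZEquiv (palindromicTwist m (4 ^ a)) (palindromicTwist m (4 ^ b)) :=
    Quotient.exact hab
  rcases lt_trichotomy a b with h | h | h
  · exact absurd hz (not_zEquiv_palindromicTwist h)
  · exact h
  · exact absurd ((zEquiv_equivalence _).symm hz) (not_zEquiv_palindromicTwist h)
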